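/- Let $G$ be a finite simple graph without isolated vertices, with maximum degree $\Delta(G)$. For an edge colouring $c$ of $G$ (not necessarily proper), say that an edge $uv$ is satisfied if some colour is assigned to exactly one edge of $E[uv]$, the set of all edges incident to $u$ or $v$ (including $uv$ itself); $c$ is conflict-free if every edge of $G$ is satisfied. Let $\chi'_{CF}(G)$ be the least number of colours in a conflict-free edge colouring of $G$. Then $$\chi'_{CF}(G)\le 3\lceil \log_2\Delta(G)\rceil+1.$$ -/

import Mathlib

namespace SimpleGraph

/-- The closed neighbourhood `E[e]` of an edge `e = uv`: all edges incident to `u` or to `v`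
(in particular `e` itself), i.e. all edges sharing an endpoint with `e`. -/
def edgeClosedNbhd {V : Type*} (G : SimpleGraph V) (e : G.edgeSet) : Set G.edgeSet :=
  {f | ∃ v : V, v ∈ (e : Sym2 V) ∧ v ∈ (f : Sym2 V)}

/-- An edge `e` is satisfied by the (not necessarily proper) edge colouring `c` if some colour is
assigned to exactly one edge of the closed neighbourhood of `e`. -/
def EdgeSatisfied {V C : Type*} (G : SimpleGraph V) (c : G.edgeSet → C) (e : G.edgeSet) : Prop :=
  ∃ a : C, ∃! f : G.edgeSet, f ∈ G.edgeClosedNbhd e ∧ c f = a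

/-- An edge colouring is conflict-free if it satisfies every edge. -/
def IsConflictFreeEdgeColoring {V C : Type*} (G : SimpleGraph V) (c : G.edgeSet → C) : Prop :=
  ∀ e : G.edgeSet, G.EdgeSatisfied c e

/-- The conflict-free chromatic index: the least number of colours admitting a conflict-free edge
colouring (`⊤` if no finite number of colours suffices). -/
noncomputable def conflictFreeChromaticIndex {V : Type*} (G : SimpleGraph V) : ℕ∞ :=
  ⨅ k ∈ {k : ℕ | ∃ c : G.edgeSet → Fin k, G.IsConflictFreeEdgeColoring c}, (k : ℕ∞)

end SimpleGraph

namespace SimpleGraph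

/-! A maximum cut leaves at most half the degree of each vertex inside the two parts. Two colours
satisfy the crossing edges (`exists_isPartialConflictFree_of_bipartite`); induction on `k`, with
fresh colours at each level (`IsPartialConflictFree.sup`), handles the rest down to a matching,
which takes one colour. Colour `0` is never a witness, so edges of other levels may carry it freely.
The total is `2 * k + 2` colours, at most `3 * k + 1` once `k ≥ 1`. -/

/-- A colouring of unordered pairs by natural numbers, with `0` read as "uncoloured", such that
every edge of `G` sees some nonzero colour exactly once. -/
def IsPartialConflictFree {V : Type*} (G : SimpleGraph V) (c : Sym2 V → ℕ) : Prop :=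
  ∀ e ∈ G.edgeSet, ∃ a ≠ 0, ∃! f, f ∈ G.edgeSet ∧ (∃ v, v ∈ e ∧ v ∈ f) ∧ c f = a

/-- Every finite graph has a bipartition such that at least half of the neighbours of every vertex
lie in the other part. -/
theorem exists_cut_two_mul_card_le {V : Type*} [Fintype V] (G : SimpleGraph V)
    [DecidableRel G.Adj] :
    ∃ s : V → Bool, ∀ v, 2 * (Finset.univ.filter fun w => G.Adj v w ∧ s v = s w).card ≤
      (Finset.univ.filter fun w => G.Adj v w).card := by
  classical
  let x : (V → Bool) → V → ℤ := fun s v => if s v then 1 else -1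
  let A : V → V → ℤ := fun u w => if G.Adj u w then 1 else 0
  let Q : (V → ℤ) → ℤ := fun y => ∑ u, ∑ w, A u w * (y u * y w)
  -- `Q` is twice the number of monochromatic edges minus crossing ones, so a minimiser is a maximum
  -- cut; flipping `v` cannot lower `Q`.
  obtain ⟨s, hs⟩ := Finite.exists_min fun s : V → Bool => Q (x s)
  refine ⟨s, fun v => ?_⟩
  have hflip := hs (Function.update s v (!s v))
  have hx : x (Function.update s v (!s v)) =
      fun u => x s u - 2 * x s v * (if u = v then 1 else 0) := by
    funext u
    by_cases h : u = v
    · subst h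
      cases hu : s u <;> simp [x, hu]
    · simp [x, h]
  have hsymm : ∀ u w, A u w = A w u := fun u w => by simp [A, G.adj_comm]
  have hAv : A v v = 0 := by simp [A]
  have hQ : Q (x (Function.update s v (!s v))) =
      Q (x s) - 4 * ∑ w, A v w * (x s v * x s w) := by
    have hterm : ∀ u w, A u w *
        ((x s u - 2 * x s v * (if u = v then 1 else 0)) *
          (x s w - 2 * x s v * (if w = v then 1 else 0))) =
        A u w * (x s u * x s w) - (if w = v then 2 * (A w u * (x s v * x s u)) else 0)
          - (if u = v then 2 * (A u w * (x s v * x s w)) else 0) := by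
      intro u w
      have := hsymm u w
      by_cases hu : u = v <;> by_cases hw : w = v
      · subst hu; subst hw; simp [hAv]
      · subst hu; simp [hw]; ring
      · subst hw; simp [hu, this]; ring
      · simp [hu, hw]
    have hcomm : ∀ u, (∑ w, if u = v then 2 * (A u w * (x s v * x s w)) else 0) =
        if u = v then ∑ w, 2 * (A u w * (x s v * x s w)) else 0 := by
      intro u; split_ifs <;> simp
    simp only [hx, Q, hterm, Finset.sum_sub_distrib, hcomm, Finset.sum_ite_eq', Finset.mem_univ,
      if_true, ← Finset.mul_sum]
    ring
  have hle : ∑ w, A v w * (x s v * x s w) ≤ 0 := by linarith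
  have hsum : ∑ w, A v w * (x s v * x s w) =
      2 * ((Finset.univ.filter fun w => G.Adj v w ∧ s v = s w).card : ℤ) -
        (Finset.univ.filter fun w => G.Adj v w).card := by
    rw [Finset.card_filter, Finset.card_filter]
    push_cast
    rw [Finset.mul_sum, ← Finset.sum_sub_distrib]
    refine Finset.sum_congr rfl fun w _ => ?_
    by_cases h : G.Adj v w <;> cases hv : s v <;> cases hw : s w <;> simp [A, x, h, hv, hw]
  omega

/-- In a finite bipartite graph, some set `T` of vertices in one part dominates every non-isolated
vertex of the other part, and every vertex of `T` has a private neighbour. -/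
theorem exists_dominating_private {V : Type*} [Finite V] (H : SimpleGraph V) (s : V → Bool)
    (hs : ∀ u w, H.Adj u w → s u ≠ s w) :
    ∃ T : Set V, (∀ t ∈ T, s t = true) ∧
      (∀ b a, s b = false → H.Adj a b → ∃ t ∈ T, H.Adj t b) ∧
      ∀ t ∈ T, ∃ b, H.Adj t b ∧ ∀ t' ∈ T, H.Adj t' b → t' = t := by
  let P : Set V → Prop := fun T => (∀ t ∈ T, s t = true) ∧
    ∀ b a, s b = false → H.Adj a b → ∃ t ∈ T, H.Adj t b
  have hP : P {t | s t = true} := by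
    refine ⟨fun t ht => ht, fun b a hb hab => ⟨a, ?_, hab⟩⟩
    have := hs a b hab
    rw [hb] at this
    simpa using this
  -- By minimality, a vertex of `T` without a private neighbour could be dropped.
  obtain ⟨T, -, hT⟩ := Finite.exists_le_minimal (p := P) hP
  refine ⟨T, hT.prop.1, hT.prop.2, fun t ht => ?_⟩
  by_contra! hcon
  have hsub : P (T \ {t}) := by
    refine ⟨fun u hu => hT.prop.1 u hu.1, fun b a hb hab => ?_⟩
    obtain ⟨u, hu, hub⟩ := hT.prop.2 b a hb hab
    by_cases hut : u = t
    · subst hut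
      obtain ⟨t', ht', h1, h2⟩ := hcon b hub
      exact ⟨t', ⟨ht', h2⟩, h1⟩
    · exact ⟨u, ⟨hu, hut⟩, hub⟩
  exact (hT.le_of_le hsub Set.sdiff_subset ht).2 rfl

/-- A finite bipartite graph has a partial conflict-free edge colouring with two colours. -/
theorem exists_isPartialConflictFree_of_bipartite {V : Type*} [Finite V] (H : SimpleGraph V)
    (s : V → Bool) (hs : ∀ u w, H.Adj u w → s u ≠ s w) :
    ∃ c : Sym2 V → ℕ, (∀ f, c f ≤ 2) ∧ H.IsPartialConflictFree c := by
  classical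
  obtain ⟨T, hTs, hdom, hpriv⟩ := exists_dominating_private H s hs
  choose! p hp hpu using hpriv
  have hq : ∀ b, (s b = false ∧ ∃ a, H.Adj a b) → ∃ t ∈ T, H.Adj t b :=
    fun b ⟨hb, a, hab⟩ => hdom b a hb hab
  choose! q hqT hq using hq
  have hps : ∀ t ∈ T, s (p t) = false := fun t ht => by
    have := hs _ _ (hp t ht)
    rw [hTs t ht] at this
    simpa using this.symm
  -- `M₁` joins each `t ∈ T` to its private neighbour; `M₂` gives every other non-isolated `b` one
  -- edge to `T`. Both meet the `true` side only in `T`.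
  let M₁ : Set (Sym2 V) := {f | ∃ t ∈ T, f = s(t, p t)}
  let M₂ : Set (Sym2 V) :=
    {f | ∃ b, s b = false ∧ (∃ a, H.Adj a b) ∧ b ∉ p '' T ∧ f = s(q b, b)}
  let c : Sym2 V → ℕ := fun f => if f ∈ M₁ then 1 else if f ∈ M₂ then 2 else 0
  have hc₁ : ∀ f, c f = 1 ↔ f ∈ M₁ := fun f => by
    by_cases h₁ : f ∈ M₁ <;> by_cases h₂ : f ∈ M₂ <;> simp [c, h₁, h₂]
  have hc₂ : ∀ f, c f = 2 → f ∈ M₂ := fun f => by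
    by_cases h₁ : f ∈ M₁ <;> by_cases h₂ : f ∈ M₂ <;> simp [c, h₁, h₂]
  refine ⟨c, fun f => by simp only [c]; split_ifs <;> omega, ?_⟩
  have main : ∀ a b, H.Adj a b → s a = true → s b = false →
      ∃ k ≠ 0, ∃! f, f ∈ H.edgeSet ∧ (∃ v, v ∈ s(a, b) ∧ v ∈ f) ∧ c f = k := by
    intro a b hab ha hb
    have hne : ∀ {x y : V}, s x = true → s y = false → x ≠ y := by
      rintro x _ hx hy rfl
      simp [hx] at hy
    by_cases haT : a ∈ T
    · refine ⟨1, one_ne_zero, s(a, p a), ⟨hp a haT, ⟨a, by simp, by simp⟩, ?_⟩, ?_⟩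
      · exact (hc₁ _).2 ⟨a, haT, rfl⟩
      · rintro f ⟨-, ⟨v, hv, hvf⟩, hf⟩
        obtain ⟨t, ht, rfl⟩ := (hc₁ _).1 hf
        have : a = t := by
          rw [Sym2.mem_iff] at hv hvf
          rcases hv with rfl | rfl <;> rcases hvf with h | h
          · exact h
          · exact absurd h (hne ha (hps t ht))
          · exact absurd h.symm (hne (hTs t ht) hb)
          -- If `b = p t`, privacy and the edge `ab` force `a = t`.
          · exact hpu t ht a haT (h ▸ hab)
        rw [this]
    · by_cases hbp : b ∈ p '' T
      · obtain ⟨t, ht, rfl⟩ := hbp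
        refine ⟨1, one_ne_zero, s(t, p t), ⟨hp t ht, ⟨p t, by simp, by simp⟩, ?_⟩, ?_⟩
        · exact (hc₁ _).2 ⟨t, ht, rfl⟩
        · rintro f ⟨-, ⟨v, hv, hvf⟩, hf⟩
          obtain ⟨u, hu, rfl⟩ := (hc₁ _).1 hf
          have : u = t := by
            rw [Sym2.mem_iff] at hv hvf
            rcases hv with rfl | rfl <;> rcases hvf with h | h
            · exact absurd (h ▸ hu) haT
            · exact absurd h (hne ha (hps u hu))
            · exact absurd h.symm (hne (hTs u hu) hb)
            · exact hpu t ht u hu (h ▸ hp u hu)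
          rw [this]
      · have hb' : s b = false ∧ ∃ a, H.Adj a b := ⟨hb, a, hab⟩
        refine ⟨2, two_ne_zero, s(q b, b), ⟨hq b hb', ⟨b, by simp, by simp⟩, ?_⟩, ?_⟩
        · have h₁ : s(q b, b) ∉ M₁ := by
            rintro ⟨t, ht, h⟩
            rw [Sym2.eq_iff] at h
            rcases h with h | h
            · exact hbp ⟨t, ht, h.2.symm⟩
            · exact hne (hTs t ht) hb h.2.symm
          have h₂ : s(q b, b) ∈ M₂ := ⟨b, hb, hb'.2, hbp, rfl⟩
          simp [c, h₁, h₂]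
        · rintro f ⟨-, ⟨v, hv, hvf⟩, hf⟩
          obtain ⟨d, hd, hd', -, rfl⟩ := hc₂ _ hf
          have : d = b := by
            rw [Sym2.mem_iff] at hv hvf
            rcases hv with rfl | rfl <;> rcases hvf with h | h
            · exact absurd (h ▸ hqT d ⟨hd, hd'⟩) haT
            · exact absurd h (hne ha hd)
            · exact absurd h.symm (hne (hTs _ (hqT d ⟨hd, hd'⟩)) hb)
            · exact h.symm
          rw [this]
  intro e
  induction e using Sym2.ind with
  | _ u w =>
    intro he
    have huw : H.Adj u w := he
    have hne := hs u w huw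
    cases hu : s u
    · have hw : s w = true := by simpa [hu] using hne.symm
      rw [Sym2.eq_swap]
      exact main w u huw.symm hw hu
    · have hw : s w = false := by simpa [hu] using hne.symm
      exact main u w huw hu hw

/-- Two partial conflict-free colourings of edge-disjoint graphs combine, on disjoint palettes, to
one of their union. -/
theorem IsPartialConflictFree.sup {V : Type*} {G H : SimpleGraph V} (hGH : Disjoint G H)
    {c d : Sym2 V → ℕ} {m n : ℕ} (hc : G.IsPartialConflictFree c) (hcm : ∀ f, c f ≤ m)
    (hd : H.IsPartialConflictFree d) (hdn : ∀ f, d f ≤ n) :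
    ∃ c' : Sym2 V → ℕ, (∀ f, c' f ≤ m + n) ∧ (G ⊔ H).IsPartialConflictFree c' := by
  classical
  have hdisj : ∀ f ∈ H.edgeSet, f ∉ G.edgeSet := fun f hH hG =>
    Set.disjoint_left.1 (disjoint_edgeSet.2 hGH) hG hH
  let c' : Sym2 V → ℕ := fun f =>
    -- Shifting `0` as well would let uncoloured edges of `H` collide with colour `m` of `G`.
    if f ∈ G.edgeSet then c f else if d f = 0 then 0 else m + d f
  have hG : ∀ f ∈ G.edgeSet, c' f = c f := fun f hf => by simp [c', hf]
  have hH : ∀ f ∈ H.edgeSet, c' f = if d f = 0 then 0 else m + d f := fun f hf => by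
    simp [c', hdisj f hf]
  refine ⟨c', fun f => ?_, fun e he => ?_⟩
  · have h₁ := hcm f
    have h₂ := hdn f
    simp only [c']
    split_ifs <;> omega
  rw [edgeSet_sup] at he ⊢
  rcases he with he | he
  · obtain ⟨a, ha, f, ⟨hf, hef, hfa⟩, huniq⟩ := hc e he
    refine ⟨a, ha, f, ⟨Or.inl hf, hef, by rw [hG f hf, hfa]⟩, ?_⟩
    rintro g ⟨hg | hg, heg, hga⟩
    · exact huniq g ⟨hg, heg, by rw [← hG g hg, hga]⟩
    · have h₁ := hcm f
      rw [hH g hg] at hga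
      split_ifs at hga <;> omega
  · obtain ⟨a, ha, f, ⟨hf, hef, hfa⟩, huniq⟩ := hd e he
    refine ⟨m + a, by omega, f, ⟨Or.inr hf, hef, by rw [hH f hf, if_neg (by omega), hfa]⟩, ?_⟩
    rintro g ⟨hg | hg, heg, hga⟩
    · have h₁ := hcm g
      rw [hG g hg] at hga
      omega
    · refine huniq g ⟨hg, heg, ?_⟩
      rw [hH g hg] at hga
      split_ifs at hga <;> omega

/-- In a graph of maximum degree at most one, edges that share a vertex are equal. -/
theorem eq_of_mem_edgeSet_of_degree_le_one {V : Type*} [Fintype V] (G : SimpleGraph V)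
    [DecidableRel G.Adj] (h : ∀ v, G.degree v ≤ 1) {e f : Sym2 V} (he : e ∈ G.edgeSet)
    (hf : f ∈ G.edgeSet) {v : V} (hve : v ∈ e) (hvf : v ∈ f) : e = f := by
  obtain ⟨x, rfl⟩ := hve
  obtain ⟨y, rfl⟩ := hvf
  have := Finset.card_le_one.1 (h v) x (by simpa using he) y (by simpa using hf)
  rw [this]

/-- A graph of maximum degree at most `2 ^ k` has a partial conflict-free edge colouring with
`2 * k + 1` colours. -/
theorem exists_isPartialConflictFree_of_degree_le {V : Type*} [Fintype V] (k : ℕ)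
    (G : SimpleGraph V) [DecidableRel G.Adj] (h : ∀ v, G.degree v ≤ 2 ^ k) :
    ∃ c : Sym2 V → ℕ, (∀ f, c f ≤ 2 * k + 1) ∧ G.IsPartialConflictFree c := by
  classical
  induction k generalizing G with
  | zero =>
    refine ⟨fun _ => 1, fun _ => le_rfl, fun e he => ⟨1, one_ne_zero, e, ⟨he, ?_, rfl⟩, ?_⟩⟩
    · exact ⟨e.out.1, e.out_fst_mem, e.out_fst_mem⟩
    · rintro f ⟨hf, ⟨v, hve, hvf⟩, -⟩
      exact G.eq_of_mem_edgeSet_of_degree_le_one h hf he hvf hve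
  | succ k ih =>
    obtain ⟨s, hs⟩ := G.exists_cut_two_mul_card_le
    let I : SimpleGraph V :=
      { Adj := fun u w => G.Adj u w ∧ s u = s w
        symm := ⟨fun _ _ h => ⟨h.1.symm, h.2.symm⟩⟩
        loopless := ⟨fun _ h => G.loopless.irrefl _ h.1⟩ }
    have hIG : I ≤ G := fun _ _ h => h.1
    have hI : ∀ v, I.degree v ≤ 2 ^ k := fun v => by
      have h₁ := hs v
      have h₂ := h v
      rw [← card_neighborFinset_eq_degree, neighborFinset_eq_filter] at h₂ ⊢
      have h₃ : (Finset.univ.filter fun w => I.Adj v w).card =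
        (Finset.univ.filter fun w => G.Adj v w ∧ s v = s w).card := by congr
      rw [pow_succ] at h₂
      omega
    obtain ⟨c, hc, hcI⟩ := ih I hI
    obtain ⟨d, hd, hdI⟩ := exists_isPartialConflictFree_of_bipartite (G \ I) s
      fun u w huw hsuw => huw.2 ⟨huw.1, hsuw⟩
    obtain ⟨c', hc', hG⟩ := hcI.sup disjoint_sdiff_self_right hc hdI hd
    rw [sup_sdiff_cancel_right hIG] at hG
    exact ⟨c', fun f => (hc' f).trans (by omega), hG⟩

/-- A conflict-free edge colouring with colours below `k` bounds the conflict-free chromatic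
index. -/
theorem conflictFreeChromaticIndex_le_of_coloring {V : Type*} {G : SimpleGraph V} {k : ℕ}
    (c : G.edgeSet → Fin k) (hc : G.IsConflictFreeEdgeColoring c) :
    G.conflictFreeChromaticIndex ≤ k :=
  iInf₂_le (f := fun (k : ℕ) (_ : k ∈ {k : ℕ | ∃ c : G.edgeSet → Fin k,
    G.IsConflictFreeEdgeColoring c}) => (k : ℕ∞)) k ⟨c, hc⟩

/-- A partial conflict-free colouring becomes a conflict-free one when all uncoloured edges receive
one additional colour. -/
theorem IsPartialConflictFree.conflictFreeChromaticIndex_le {V : Type*} {G : SimpleGraph V}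
    {c : Sym2 V → ℕ} {m : ℕ} (hc : G.IsPartialConflictFree c) (hm : ∀ f, c f ≤ m) :
    G.conflictFreeChromaticIndex ≤ (m + 1 : ℕ) := by
  refine conflictFreeChromaticIndex_le_of_coloring
    (fun f => ⟨c f, Nat.lt_succ_of_le (hm f)⟩) fun e => ?_
  obtain ⟨a, -, f, ⟨hf, hef, rfl⟩, huniq⟩ := hc e e.2
  refine ⟨⟨c f, Nat.lt_succ_of_le (hm f)⟩, ⟨f, hf⟩, ⟨hef, rfl⟩, ?_⟩
  rintro ⟨g, hg⟩ ⟨heg, hga⟩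
  exact Subtype.ext (huniq g ⟨hg, heg, congrArg Fin.val hga⟩)

/-- A graph of maximum degree at most one has conflict-free chromatic index at most one. -/
theorem conflictFreeChromaticIndex_le_one {V : Type*} [Fintype V] (G : SimpleGraph V)
    [DecidableRel G.Adj] (h : ∀ v, G.degree v ≤ 1) :
    G.conflictFreeChromaticIndex ≤ (1 : ℕ) := by
  refine conflictFreeChromaticIndex_le_of_coloring (fun _ => 0) fun e => ⟨0, e, ⟨?_, rfl⟩, ?_⟩
  · exact ⟨_, (e : Sym2 V).out_fst_mem, (e : Sym2 V).out_fst_mem⟩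
  · rintro f ⟨⟨v, hve, hvf⟩, -⟩
    exact Subtype.ext (G.eq_of_mem_edgeSet_of_degree_le_one h f.2 e.2 hvf hve)

end SimpleGraph

theorem mainTheorem3 {V : Type*} [Fintype V] (G : SimpleGraph V) [DecidableRel G.Adj]
    (hG : ∀ v : V, ¬ G.IsIsolated v) :
    G.conflictFreeChromaticIndex ≤ ((3 * ⌈Real.logb 2 (G.maxDegree : ℝ)⌉₊ + 1 : ℕ) : ℕ∞) := by
  set k := ⌈Real.logb 2 (G.maxDegree : ℝ)⌉₊
  have hΔ : G.maxDegree ≤ 2 ^ k := by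
    rcases Nat.eq_zero_or_pos G.maxDegree with h | h
    · simp [h]
    · have h₁ : Real.logb 2 (G.maxDegree : ℝ) ≤ (k : ℝ) := Nat.le_ceil _
      rw [Real.logb_le_iff_le_rpow one_lt_two (by exact_mod_cast h), Real.rpow_natCast] at h₁
      exact_mod_cast h₁
  have hdeg : ∀ v, G.degree v ≤ 2 ^ k := fun v => (G.degree_le_maxDegree v).trans hΔ
  -- `2 * k + 2 ≤ 3 * k + 1` fails only at `k = 0`, where no extra colour for uncoloured edges is
  -- needed.
  rcases Nat.eq_zero_or_pos k with h | h
  · rw [h] at hdeg ⊢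
    exact G.conflictFreeChromaticIndex_le_one (by simpa using hdeg)
  · obtain ⟨c, hc, hcG⟩ := G.exists_isPartialConflictFree_of_degree_le k hdeg
    exact (hcG.conflictFreeChromaticIndex_le hc).trans (by exact_mod_cast (by omega))
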